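/- Call $f:\mathbb{N}\to\mathbb{C}$ multiplicative if $f(1)=1$ and $f(ab)=f(a)f(b)$ for all coprime $a,b\ge 1$, and completely multiplicative if $f(1)=1$ and $f(ab)=f(a)f(b)$ for all $a,b\ge 1$. Throughout, $p$ denotes a prime. For $y>0$ put \[ s(f,y)=\sum_{p\le y}\frac{|1-f(p)|}{p},\qquad \Theta(f,y)=\prod_{p\le y}\Bigl(1+\frac{f(p)}{p}+\frac{f(p^2)}{p^2}+\cdots\Bigr)\Bigl(1-\frac1p\Bigr). \] There is an absolute constant $C>0$ such that the following holds. Let $f$ be a multiplicative function with $|f(p^k)|\le 1$ for every prime power $p^k$, let $x>1$ and $\epsilon$ be real numbers with $\log 2/\log x\le\epsilon<1$, and let $g$ be the completely multiplicative function with $g(p)=1$ for $p\le x^{\epsilon}$ and $g(p)=f(p)$ for $p>x^{\epsilon}$. Then there is a complex number $\delta$ with $|\delta|\le C x^{-\epsilon}$ such that \[ \Bigl|\frac1x\sum_{n\le x}f(n)-\Theta(f,x^{\epsilon})\,(1+\delta)\,\frac1x\sum_{n\le x}g(n)\Bigr|\le C\,\epsilon\,\exp\bigl(s(f,x)\bigr).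 \] In other words, with absolute implied constants, \[ \frac1x\sum_{n\le x}f(n)=\Theta(f,x^{\epsilon})\bigl(1+O(x^{-\epsilon})\bigr)\frac1x\sum_{n\le x}g(n)+O\bigl(\epsilon\exp(s(f,x))\bigr). \] -/

import Mathlib

open scoped BigOperators

noncomputable section

/-- The finite set of primes `p ≤ y`, for a real number `y`. -/
def primesUpTo (y : ℝ) : Finset ℕ :=
  (Finset.Icc 1 ⌊y⌋₊).filter Nat.Prime

/-- The mean value `(1/x) * ∑_{1 ≤ n ≤ x} F n`. -/
def meanValue (F : ℕ → ℂ) (x : ℝ) : ℂ :=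
  (1 / (x : ℂ)) * ∑ n ∈ Finset.Icc 1 ⌊x⌋₊, F n

/-- The Euler product
`Θ(f, y) = ∏_{p ≤ y} (1 + f(p)/p + f(p^2)/p^2 + ⋯) (1 - 1/p)`. -/
def eulerTheta (f : ℕ → ℂ) (y : ℝ) : ℂ :=
  ∏ p ∈ primesUpTo y,
    (1 + ∑' k : ℕ, f (p ^ (k + 1)) / (p : ℂ) ^ (k + 1)) * (1 - 1 / (p : ℂ))

/-- The sum `s(f, x) = ∑_{p ≤ x} |1 - f(p)| / p`. -/
def primeDistance (f : ℕ → ℂ) (x : ℝ) : ℝ :=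
  ∑ p ∈ primesUpTo x, ‖1 - f p‖ / (p : ℝ)

end

/-! Put `y = x ^ ε` and factor `f = h * G` as a Dirichlet convolution, `G` being `g`. Then `h`
vanishes at primes above `y`, and `‖h p‖ = ‖1 - f p‖` below. The mean value of `f` at `x` is the sum
of `h n / n` times the mean value of `G` at `x / n`.

Mean values of `G` vary slowly: passing from `x` to `x / n` costs `O((log n + 1) / log x * exp(s(g,
x)))` (`norm_meanValue_div_sub_le`). For this, write `G = κ * ζ` with `κ = G * μ`. The logarithmic
derivative of `κ` gives `|κ| log ≤ 2 |κ| * Λ`, and Chebyshev and Mertens bounds then control the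
sums of `|κ|`.

With the mean value frozen at `x`, the main term is the sum of `h n / n` over `x`-smooth `n`, an
Euler product. Its factors at `p ≤ y` form `Θ(f, y)`; those at `p > y` are `1 + O(p⁻²)` and form `1
+ δ`.

In the error, `log n + 1 ≪ log y * n ^ σ` with `σ = 1 / (4 log y)`. The sum of `‖h n‖ n ^ (σ - 1)`
is `O(exp(s(f, y)))` by Rankin's trick (`weighted_smooth_sum`, `sum_primes_rpow_le`). Since `log y /
log x = ε` and `s(f, y) + s(g, x) = s(f, x)`, the error is as claimed. -/

open ArithmeticFunction
open scoped ArithmeticFunction.Moebius ArithmeticFunction.zeta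

/-! ### Dirichlet convolution and logarithmic derivatives. -/

namespace ArithmeticFunction

/-- Multiplication by a completely multiplicative function distributes over convolution. -/
theorem pmul_mul_of_map_mul {R : Type*} [CommSemiring R] {G : ArithmeticFunction R}
    (hG : ∀ m n, G (m * n) = G m * G n) (a b : ArithmeticFunction R) :
    (a * b).pmul G = a.pmul G * b.pmul G := by
  ext n
  simp only [pmul_apply, mul_apply, Finset.sum_mul]
  refine Finset.sum_congr rfl fun q hq => ?_
  rw [← (Nat.mem_divisorsAntidiagonal.mp hq).1, hG]
  ring

/-- The Dirichlet inverse of a completely multiplicative function `G` is `μ G`. -/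
theorem moebius_pmul_mul_self {R : Type*} [CommRing R] {G : ArithmeticFunction R}
    (hG1 : G 1 = 1) (hG : ∀ m n, G (m * n) = G m * G n) :
    ((μ : ArithmeticFunction ℤ) : ArithmeticFunction R).pmul G * G = 1 := by
  have h := pmul_mul_of_map_mul hG ((μ : ArithmeticFunction ℤ) : ArithmeticFunction R) ((ζ : ArithmeticFunction ℕ) : ArithmeticFunction R)
  rw [coe_moebius_mul_coe_zeta, zeta_pmul] at h
  rw [← h]
  ext n
  by_cases hn : n = 1
  · simp [hn, hG1]
  · simp [one_apply_ne hn]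

/-- Values at prime powers of the Dirichlet quotient of `f` by a completely multiplicative
function `G`. -/
theorem apply_prime_pow_succ_of_mul_eq {R : Type*} [CommRing R] {h G f : ArithmeticFunction R}
    (hG1 : G 1 = 1) (hG : ∀ m n, G (m * n) = G m * G n) (hf : h * G = f) {p : ℕ}
    (hp : p.Prime) (k : ℕ) :
    h (p ^ (k + 1)) = f (p ^ (k + 1)) - G p * f (p ^ k) := by
  have key : ∀ j, f (p ^ j) = ∑ i ∈ Finset.range (j + 1), h (p ^ i) * G (p ^ (j - i)) := by
    intro j
    rw [← hf, mul_apply, Nat.sum_divisorsAntidiagonal (fun a b => h a * G b),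
      Nat.sum_divisors_prime_pow hp]
    refine Finset.sum_congr rfl fun i hi => ?_
    rw [Nat.pow_div (by simpa [Nat.lt_succ_iff] using hi) hp.pos]
  rw [key (k + 1), key k, Finset.sum_range_succ, Finset.mul_sum, Nat.sub_self, pow_zero, hG1,
    mul_one]
  have : ∑ i ∈ Finset.range (k + 1), h (p ^ i) * G (p ^ (k + 1 - i)) =
      ∑ i ∈ Finset.range (k + 1), G p * (h (p ^ i) * G (p ^ (k - i))) := by
    refine Finset.sum_congr rfl fun i hi => ?_
    have hi' : i ≤ k := by simpa [Nat.lt_succ_iff] using hi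
    rw [Nat.succ_sub hi', pow_succ, hG]
    ring
  rw [this]
  ring

/-- A real arithmetic function, seen as a complex one. -/
def ofReal (a : ArithmeticFunction ℝ) : ArithmeticFunction ℂ :=
  ⟨fun n => ((a n : ℝ) : ℂ), by simp⟩

theorem ofReal_apply (a : ArithmeticFunction ℝ) (n : ℕ) : ofReal a n = ((a n : ℝ) : ℂ) := rfl

theorem ofReal_mul (a b : ArithmeticFunction ℝ) : ofReal (a * b) = ofReal a * ofReal b := by
  ext n
  simp [ofReal_apply, mul_apply]

theorem ofReal_zeta : ofReal ((ζ : ArithmeticFunction ℕ) : ArithmeticFunction ℝ) = ((ζ : ArithmeticFunction ℕ) : ArithmeticFunction ℂ) := by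
  ext n
  by_cases hn : n = 0 <;> simp [ofReal_apply, hn]

/-- The pointwise absolute value of a complex arithmetic function. -/
noncomputable def absValue (a : ArithmeticFunction ℂ) : ArithmeticFunction ℝ :=
  ⟨fun n => ‖a n‖, by simp⟩

theorem absValue_apply (a : ArithmeticFunction ℂ) (n : ℕ) : absValue a n = ‖a n‖ := rfl

theorem absValue_nonneg (a : ArithmeticFunction ℂ) (n : ℕ) : 0 ≤ absValue a n := by
  rw [absValue_apply]; positivity

/-- The pointwise product with the logarithm is a derivation. -/
theorem mul_pmul_log (a b : ArithmeticFunction ℂ) :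
    (a * b).pmul (ofReal log) = a.pmul (ofReal log) * b + a * b.pmul (ofReal log) := by
  ext n
  simp only [pmul_apply, mul_apply, add_apply, Finset.sum_mul, ← Finset.sum_add_distrib]
  refine Finset.sum_congr rfl fun q hq => ?_
  obtain ⟨hq1, hn⟩ := Nat.mem_divisorsAntidiagonal.mp hq
  have h1 : q.1 ≠ 0 := by rintro h; simp [h] at hq1; exact hn hq1.symm
  have h2 : q.2 ≠ 0 := by rintro h; simp [h] at hq1; exact hn hq1.symm
  rw [← hq1]
  simp only [ofReal_apply, log_apply]
  rw [Nat.cast_mul, Real.log_mul (by exact_mod_cast h1) (by exact_mod_cast h2)]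
  push_cast
  ring

/-- For `G` completely multiplicative, the "logarithmic derivative" of `G * μ`. -/
theorem mul_moebius_pmul_log {G : ArithmeticFunction ℂ} (hG : ∀ m n, G (m * n) = G m * G n) :
    (G * ((μ : ArithmeticFunction ℤ) : ArithmeticFunction ℂ)).pmul (ofReal log) =
      (G * ((μ : ArithmeticFunction ℤ) : ArithmeticFunction ℂ)) * ((ofReal vonMangoldt).pmul G - ofReal vonMangoldt) := by
  set k := G * ((μ : ArithmeticFunction ℤ) : ArithmeticFunction ℂ) with hk
  have hζ : ((μ : ArithmeticFunction ℤ) : ArithmeticFunction ℂ) * ((ζ : ArithmeticFunction ℕ) : ArithmeticFunction ℂ) = 1 :=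
    coe_moebius_mul_coe_zeta
  have hlog : ofReal log = ofReal vonMangoldt * ((ζ : ArithmeticFunction ℕ) : ArithmeticFunction ℂ) := by
    rw [← ofReal_zeta, ← ofReal_mul, vonMangoldt_mul_zeta]
  have hkG : k * ((ζ : ArithmeticFunction ℕ) : ArithmeticFunction ℂ) = G := by rw [hk, mul_assoc, hζ, mul_one]
  -- `G log` is computed twice, by the derivation rule on `k * ζ` and as `G` times `Λ * ζ`; the
  -- common factor `ζ` is then cancelled with `μ`.
  have h1 := mul_pmul_log k ((ζ : ArithmeticFunction ℕ) : ArithmeticFunction ℂ)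
  have h2 := pmul_mul_of_map_mul hG (ofReal vonMangoldt) ((ζ : ArithmeticFunction ℕ) : ArithmeticFunction ℂ)
  rw [hkG, zeta_pmul, hlog] at h1
  rw [zeta_pmul] at h2
  rw [pmul_comm, h2] at h1
  rw [← hlog] at h1
  have h3 : k.pmul (ofReal log) * ((ζ : ArithmeticFunction ℕ) : ArithmeticFunction ℂ) =
      k * ((ofReal vonMangoldt).pmul G - ofReal vonMangoldt) * ((ζ : ArithmeticFunction ℕ) : ArithmeticFunction ℂ) := by
    rw [eq_sub_of_add_eq h1.symm, hlog]
    nth_rewrite 2 [← hkG]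
    ring
  calc k.pmul (ofReal log)
      = k.pmul (ofReal log) * ((ζ : ArithmeticFunction ℕ) : ArithmeticFunction ℂ) * ((μ : ArithmeticFunction ℤ) : ArithmeticFunction ℂ) := by
        rw [mul_assoc, mul_comm ((ζ : ArithmeticFunction ℕ) : ArithmeticFunction ℂ), hζ, mul_one]
    _ = _ := by rw [h3, mul_assoc, mul_comm ((ζ : ArithmeticFunction ℕ) : ArithmeticFunction ℂ), hζ, mul_one]

/-- Absolute values in the preceding identity, with `|ΛG - Λ| ≤ 2Λ`. This inequality serves below as
hypothesis `hlog`. -/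
theorem norm_mul_moebius_mul_log_le {G : ArithmeticFunction ℂ}
    (hG : ∀ m n, G (m * n) = G m * G n) (hbound : ∀ n, ‖G n‖ ≤ 1) (n : ℕ) :
    absValue (G * ((μ : ArithmeticFunction ℤ) : ArithmeticFunction ℂ)) n * Real.log n ≤
      2 * (absValue (G * ((μ : ArithmeticFunction ℤ) : ArithmeticFunction ℂ)) * vonMangoldt) n := by
  have h := congrArg (fun a : ArithmeticFunction ℂ => ‖a n‖) (mul_moebius_pmul_log hG)
  set k := G * ((μ : ArithmeticFunction ℤ) : ArithmeticFunction ℂ)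
  simp only [pmul_apply, ofReal_apply, log_apply, norm_mul, Complex.norm_real,
    Real.norm_of_nonneg (Real.log_natCast_nonneg n)] at h
  rw [absValue_apply, h, mul_apply, mul_apply, Finset.mul_sum]
  refine (norm_sum_le _ _).trans (Finset.sum_le_sum fun q _ => ?_)
  rw [norm_mul, absValue_apply]
  have : ‖((ofReal vonMangoldt).pmul G - ofReal vonMangoldt) q.2‖ ≤ 2 * vonMangoldt q.2 := by
    have e : ((ofReal vonMangoldt).pmul G - ofReal vonMangoldt) q.2 = ((vonMangoldt q.2 : ℝ) : ℂ) * (G q.2 - 1) := by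
      change (ofReal vonMangoldt).pmul G q.2 - ofReal vonMangoldt q.2 = _
      rw [pmul_apply, ofReal_apply]; ring
    rw [e, norm_mul, Complex.norm_real, Real.norm_of_nonneg vonMangoldt_nonneg]
    have := (norm_sub_le (G q.2) 1).trans (add_le_add (hbound q.2) norm_one.le)
    nlinarith [vonMangoldt_nonneg (n := q.2)]
  nlinarith [norm_nonneg (k q.1)]

end ArithmeticFunction

/-! ### Chebyshev and Mertens bounds. -/

/-- The constant in Chebyshev's bound `ψ x ≤ c x`. -/
noncomputable def chebyshevConst : ℝ := Real.log 4 + 4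

theorem chebyshevConst_pos : 0 < chebyshevConst := by
  have : 0 < Real.log 4 := Real.log_pos (by norm_num)
  unfold chebyshevConst; linarith

theorem sum_vonMangoldt_mul_div (N : ℕ) :
    ∑ n ∈ Finset.Ioc 0 N, vonMangoldt n * ((N / n : ℕ) : ℝ) = Real.log (N.factorial : ℝ) := by
  rw [← sum_Ioc_mul_zeta_eq_sum, vonMangoldt_mul_zeta]
  induction N with
  | zero => simp
  | succ n ih =>
    rw [Finset.sum_Ioc_succ_top (Nat.zero_le n), ih, Nat.factorial_succ, Nat.cast_mul,
      Real.log_mul (by positivity) (by positivity), log_apply]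
    ring

theorem self_mul_log_sub_le_log_factorial (N : ℕ) :
    N * Real.log N - N ≤ Real.log (N.factorial : ℝ) := by
  rcases Nat.eq_zero_or_pos N with rfl | hN
  · simp
  · have h := Stirling.le_log_factorial_stirling hN.ne'
    have h1 : 0 ≤ Real.log (N : ℝ) := Real.log_natCast_nonneg N
    have h2 : 0 ≤ Real.log (2 * Real.pi) := Real.log_nonneg (by nlinarith [Real.pi_gt_three])
    linarith

theorem log_factorial_le (N : ℕ) : Real.log (N.factorial : ℝ) ≤ N * Real.log N := by
  rw [← Real.log_pow]
  exact Real.log_le_log (by positivity) (by exact_mod_cast Nat.factorial_le_pow N)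

/-- The sum `∑_{n ≤ t} Λ(n) / n`. -/
noncomputable def mertensSum (t : ℝ) : ℝ :=
  ∑ n ∈ Finset.Ioc 0 ⌊t⌋₊, vonMangoldt n / n

theorem mertensSum_nonneg (t : ℝ) : 0 ≤ mertensSum t :=
  Finset.sum_nonneg fun n _ => div_nonneg vonMangoldt_nonneg n.cast_nonneg

theorem mertensSum_le {t : ℝ} (ht : 1 ≤ t) : mertensSum t ≤ Real.log t + chebyshevConst := by
  set N := ⌊t⌋₊ with hN
  have hN1 : 1 ≤ N := (Nat.one_le_floor_iff t).mpr ht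
  have hN0 : (0 : ℝ) < N := by exact_mod_cast hN1
  have hle : (N : ℝ) ≤ t := Nat.floor_le (by linarith)
  have key : N * mertensSum t ≤ N * (Real.log N + chebyshevConst) := by
    have h1 : N * mertensSum t ≤
        ∑ n ∈ Finset.Ioc 0 N, (vonMangoldt n * ((N / n : ℕ) : ℝ) + vonMangoldt n) := by
      rw [mertensSum, Finset.mul_sum]
      refine Finset.sum_le_sum fun n hn => ?_
      have hn0 : 0 < n := (Finset.mem_Ioc.mp hn).1
      have h2 : (N : ℝ) / n < ((N / n : ℕ) : ℝ) + 1 := by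
        rw [← Nat.floor_div_eq_div (K := ℝ)]
        exact Nat.lt_floor_add_one _
      calc (N : ℝ) * (vonMangoldt n / n) = vonMangoldt n * ((N : ℝ) / n) := by ring
        _ ≤ vonMangoldt n * (((N / n : ℕ) : ℝ) + 1) :=
          mul_le_mul_of_nonneg_left h2.le vonMangoldt_nonneg
        _ = _ := by ring
    rw [Finset.sum_add_distrib, sum_vonMangoldt_mul_div] at h1
    have h3 : ∑ n ∈ Finset.Ioc 0 N, vonMangoldt n ≤ chebyshevConst * N := by
      have := Chebyshev.psi_le_const_mul_self (x := N) (Nat.cast_nonneg N)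
      rwa [Chebyshev.psi, Nat.floor_natCast] at this
    have h4 := log_factorial_le N
    linarith
  have := le_of_mul_le_mul_left key hN0
  linarith [Real.log_le_log hN0 hle]

theorem le_mertensSum {t : ℝ} (ht : 1 ≤ t) : Real.log t - 2 ≤ mertensSum t := by
  set N := ⌊t⌋₊ with hN
  have hN1 : 1 ≤ N := (Nat.one_le_floor_iff t).mpr ht
  have hN0 : (0 : ℝ) < N := by exact_mod_cast hN1
  have key : N * (Real.log N - 1) ≤ N * mertensSum t := by
    have h1 : ∑ n ∈ Finset.Ioc 0 N, vonMangoldt n * ((N / n : ℕ) : ℝ) ≤ N * mertensSum t := by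
      rw [mertensSum, Finset.mul_sum]
      refine Finset.sum_le_sum fun n hn => ?_
      calc vonMangoldt n * ((N / n : ℕ) : ℝ) ≤ vonMangoldt n * ((N : ℝ) / n) :=
            mul_le_mul_of_nonneg_left Nat.cast_div_le vonMangoldt_nonneg
        _ = _ := by ring
    rw [sum_vonMangoldt_mul_div] at h1
    linarith [self_mul_log_sub_le_log_factorial N]
  have h2 := le_of_mul_le_mul_left key hN0
  -- Passing from `t` to its floor loses at most `log 2 < 1`, whence the constant `2`.
  have h3 : t ≤ N * 2 := by
    have : t < N + 1 := Nat.lt_floor_add_one t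
    have : (1 : ℝ) ≤ N := by exact_mod_cast hN1
    linarith
  have h4 := Real.log_le_log (by linarith) h3
  rw [Real.log_mul hN0.ne' (by norm_num)] at h4
  linarith [Real.log_two_lt_d9]

theorem mertensSum_sub_le {z w : ℝ} (hz : 1 ≤ z) (hw : 1 ≤ w) :
    mertensSum z - mertensSum (z / w) ≤ Real.log w + (chebyshevConst + 2) := by
  have h := mertensSum_le hz
  by_cases h1 : 1 ≤ z / w
  · have h2 := le_mertensSum h1
    rw [Real.log_div (by linarith) (by linarith)] at h2
    linarith
  · have h2 := Real.log_le_log (by linarith) ((div_lt_one (by linarith)).mp (not_le.mp h1)).le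
    linarith [mertensSum_nonneg (z / w)]

/-! ### Nonnegative functions with `a log ≤ 2 a * Λ`. -/

section LogControlled

variable {a : ArithmeticFunction ℝ}

/-- The sum `∑_{n ≤ t} a(n) / n`. -/
noncomputable def logSum (a : ArithmeticFunction ℝ) (t : ℝ) : ℝ :=
  ∑ n ∈ Finset.Ioc 0 ⌊t⌋₊, a n / n

theorem logSum_mono (ha : ∀ n, 0 ≤ a n) : Monotone (logSum a) := fun _ _ hst =>
  Finset.sum_le_sum_of_subset_of_nonneg
    (Finset.Ioc_subset_Ioc_right (Nat.floor_mono hst))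
    fun n _ _ => div_nonneg (ha n) n.cast_nonneg

/-- Split `log t = log n + log (t / n)`: the hypothesis and Chebyshev's bound handle the first part,
`log u ≤ u` the second. -/
theorem sum_mul_log_le (ha : ∀ n, 0 ≤ a n)
    (hlog : ∀ n, a n * Real.log n ≤ 2 * (a * vonMangoldt) n) {t : ℝ} (ht : 1 ≤ t) :
    (∑ n ∈ Finset.Ioc 0 ⌊t⌋₊, a n) * Real.log t ≤ (2 * chebyshevConst + 1) * (t * logSum a t) := by
  have h1 : ∑ n ∈ Finset.Ioc 0 ⌊t⌋₊, a n * Real.log n ≤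
      2 * ∑ n ∈ Finset.Ioc 0 ⌊t⌋₊, a n * (chebyshevConst * (t / n)) := by
    calc _ ≤ ∑ n ∈ Finset.Ioc 0 ⌊t⌋₊, 2 * (a * vonMangoldt) n :=
          Finset.sum_le_sum fun n _ => hlog n
      _ = 2 * ∑ n ∈ Finset.Ioc 0 ⌊t⌋₊, a n * Chebyshev.psi (t / n) := by
          rw [← Finset.mul_sum, sum_Ioc_mul_eq_sum_sum]
          simp only [Chebyshev.psi, Nat.floor_div_natCast]
      _ ≤ _ := by
          gcongr with n hn
          · exact ha n
          · exact Chebyshev.psi_le_const_mul_self (by positivity)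
  have h2 : ∑ n ∈ Finset.Ioc 0 ⌊t⌋₊, a n * (Real.log t - Real.log n) ≤
      ∑ n ∈ Finset.Ioc 0 ⌊t⌋₊, a n * (t / n) := by
    refine Finset.sum_le_sum fun n hn => mul_le_mul_of_nonneg_left ?_ (ha n)
    have hn0 : (0 : ℝ) < n := by exact_mod_cast (Finset.mem_Ioc.mp hn).1
    rw [← Real.log_div (by linarith) hn0.ne']
    exact Real.log_le_self (by positivity)
  have h3 : ∑ n ∈ Finset.Ioc 0 ⌊t⌋₊, a n * (t / n) = t * logSum a t := by
    rw [logSum, Finset.mul_sum]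
    exact Finset.sum_congr rfl fun n _ => by ring
  have h4 : ∑ n ∈ Finset.Ioc 0 ⌊t⌋₊, a n * (chebyshevConst * (t / n)) =
      chebyshevConst * (t * logSum a t) := by
    rw [← h3, Finset.mul_sum]
    exact Finset.sum_congr rfl fun n _ => by ring
  have h5 : (∑ n ∈ Finset.Ioc 0 ⌊t⌋₊, a n) * Real.log t =
      ∑ n ∈ Finset.Ioc 0 ⌊t⌋₊, a n * (Real.log t - Real.log n) +
        ∑ n ∈ Finset.Ioc 0 ⌊t⌋₊, a n * Real.log n := by
    rw [← Finset.sum_add_distrib, Finset.sum_mul]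
    exact Finset.sum_congr rfl fun n _ => by ring
  rw [h4] at h1
  rw [h3] at h2
  linarith

/-- The arithmetic function `a(n) / n`. -/
noncomputable def overId (a : ArithmeticFunction ℝ) : ArithmeticFunction ℝ :=
  ⟨fun n => a n / n, by simp⟩

theorem overId_apply (a : ArithmeticFunction ℝ) (n : ℕ) : overId a n = a n / n := rfl

theorem overId_mul (a b : ArithmeticFunction ℝ) : overId (a * b) = overId a * overId b := by
  ext n
  simp only [overId_apply, mul_apply, Finset.sum_div]
  refine Finset.sum_congr rfl fun q hq => ?_
  rw [← (Nat.mem_divisorsAntidiagonal.mp hq).1, Nat.cast_mul, mul_div_mul_comm]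

/-- The free bound `B` lets the sums at `x` and at `x / w` run over the same range; the extra terms
vanish because `mertensSum` is empty below `1`. -/
theorem logSum_convolution (a : ArithmeticFunction ℝ) {t : ℝ} {B : ℕ} (hB : ⌊t⌋₊ ≤ B) :
    logSum (a * vonMangoldt) t = ∑ n ∈ Finset.Ioc 0 B, a n / n * mertensSum (t / n) := by
  have h1 : logSum (a * vonMangoldt) t =
      ∑ n ∈ Finset.Ioc 0 ⌊t⌋₊, (overId a * overId vonMangoldt) n := by
    rw [← overId_mul]; rfl
  rw [h1, sum_Ioc_mul_eq_sum_sum]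
  simp only [mertensSum, Nat.floor_div_natCast, overId_apply]
  refine Finset.sum_subset (Finset.Ioc_subset_Ioc_right hB) fun n hn hn' => ?_
  have : ⌊t⌋₊ / n = 0 := by
    apply Nat.div_eq_of_lt
    simp only [Finset.mem_Ioc] at hn hn'
    omega
  simp [this]

/-- On `(x / w, x]` the weight `log n` exceeds `log (x / w)`. After unfolding `a * Λ`, only the part
of a Mertens sum between `x / n / w` and `x / n` remains, of size `log w + O(1)`. -/
theorem logSum_sub_mul_log_le (ha : ∀ n, 0 ≤ a n)
    (hlog : ∀ n, a n * Real.log n ≤ 2 * (a * vonMangoldt) n) {x w : ℝ} (hw : 1 ≤ w)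
    (hwx : w ≤ x) :
    (logSum a x - logSum a (x / w)) * Real.log (x / w) ≤
      2 * (Real.log w + (chebyshevConst + 2)) * logSum a x := by
  have hx : 1 ≤ x := hw.trans hwx
  have hxw : 1 ≤ x / w := (one_le_div (by linarith)).mpr hwx
  have hle : x / w ≤ x := div_le_self (by linarith) hw
  have hfl : ⌊x / w⌋₊ ≤ ⌊x⌋₊ := Nat.floor_mono hle
  have split : ∀ F : ℕ → ℝ, ∑ n ∈ Finset.Ioc 0 ⌊x⌋₊, F n - ∑ n ∈ Finset.Ioc 0 ⌊x / w⌋₊, F n =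
      ∑ n ∈ Finset.Ioc ⌊x / w⌋₊ ⌊x⌋₊, F n := fun F => by
    rw [← Finset.sum_Ioc_consecutive F (Nat.zero_le _) hfl]; ring
  calc (logSum a x - logSum a (x / w)) * Real.log (x / w)
      = ∑ n ∈ Finset.Ioc ⌊x / w⌋₊ ⌊x⌋₊, a n / n * Real.log (x / w) := by
        rw [logSum, logSum, split, Finset.sum_mul]
    _ ≤ ∑ n ∈ Finset.Ioc ⌊x / w⌋₊ ⌊x⌋₊, 2 * ((a * vonMangoldt) n / n) := by
        refine Finset.sum_le_sum fun n hn => ?_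
        have hn0 : x / w < n := (Nat.floor_lt (by linarith)).mp (Finset.mem_Ioc.mp hn).1
        have hn1 : (0 : ℝ) < n := by linarith
        calc a n / n * Real.log (x / w) ≤ a n / n * Real.log n := by
              gcongr
              exact div_nonneg (ha n) hn1.le
          _ = a n * Real.log n / n := by ring
          _ ≤ 2 * (a * vonMangoldt) n / n := div_le_div_of_nonneg_right (hlog n) hn1.le
          _ = _ := by ring
    _ = 2 * (logSum (a * vonMangoldt) x - logSum (a * vonMangoldt) (x / w)) := by
        rw [logSum, logSum, split, Finset.mul_sum]
    _ = 2 * ∑ n ∈ Finset.Ioc 0 ⌊x⌋₊, a n / n * (mertensSum (x / n) - mertensSum (x / n / w)) := by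
        rw [logSum_convolution a le_rfl, logSum_convolution a hfl, ← Finset.sum_sub_distrib]
        congr 1
        refine Finset.sum_congr rfl fun n _ => ?_
        rw [div_right_comm x w]; ring
    _ ≤ 2 * ∑ n ∈ Finset.Ioc 0 ⌊x⌋₊, a n / n * (Real.log w + (chebyshevConst + 2)) := by
        refine mul_le_mul_of_nonneg_left (Finset.sum_le_sum fun n hn => ?_) (by norm_num)
        obtain ⟨hn0, hnx⟩ := Finset.mem_Ioc.mp hn
        have hn1 : (0 : ℝ) < n := by exact_mod_cast hn0
        refine mul_le_mul_of_nonneg_left (mertensSum_sub_le ?_ hw) (div_nonneg (ha n) hn1.le)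
        rw [one_le_div hn1]
        exact (Nat.le_floor_iff (by linarith)).mp hnx
    _ = _ := by rw [← Finset.sum_mul, logSum]; ring

end LogControlled

/-! ### Euler product bounds over smooth numbers. -/

theorem primesUpTo_eq_primesBelow (x : ℝ) : primesUpTo x = Nat.primesBelow (⌊x⌋₊ + 1) := by
  ext p
  simp only [primesUpTo, Nat.primesBelow, Finset.mem_filter, Finset.mem_Icc, Finset.mem_range]
  exact ⟨fun h => ⟨by omega, h.2⟩, fun h => ⟨⟨h.2.one_lt.le, by omega⟩, h.2⟩⟩

theorem mem_primesUpTo {x : ℝ} (hx : 0 ≤ x) {p : ℕ} :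
    p ∈ primesUpTo x ↔ p.Prime ∧ (p : ℝ) ≤ x := by
  simp only [primesUpTo, Finset.mem_filter, Finset.mem_Icc, Nat.le_floor_iff hx]
  exact ⟨fun h => ⟨h.2, h.1.2⟩, fun h => ⟨⟨h.1.one_lt.le, h.2⟩, h.1⟩⟩

/-- A power series with coefficients bounded by `2`, compared with its linear part. -/
theorem summable_and_tsum_le_of_norm_le_two {v : ℕ → ℂ} (hv : ∀ j, ‖v j‖ ≤ 2) {q : ℝ}
    (hq0 : 0 ≤ q) (hq1 : q < 1) :
    Summable (fun j => ‖v j‖ * q ^ j) ∧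
      ∑' j, ‖v (j + 2)‖ * q ^ (j + 2) ≤ 2 * (q ^ 2 / (1 - q)) ∧
      ∑' j, ‖v j‖ * q ^ j ≤ ‖v 0‖ + ‖v 1‖ * q + 2 * (q ^ 2 / (1 - q)) := by
  have hgeo : HasSum (fun j : ℕ => 2 * (q ^ 2 * q ^ j)) (2 * (q ^ 2 / (1 - q))) :=
    ((hasSum_geometric_of_lt_one hq0 hq1).mul_left (q ^ 2)).mul_left 2
  have hs : Summable (fun j => ‖v j‖ * q ^ j) := by
    refine Summable.of_nonneg_of_le (fun j => by positivity) (fun j => ?_)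
      ((summable_geometric_of_lt_one hq0 hq1).mul_left 2)
    exact mul_le_mul_of_nonneg_right (hv j) (by positivity)
  have htail : ∑' j, ‖v (j + 2)‖ * q ^ (j + 2) ≤ 2 * (q ^ 2 / (1 - q)) := by
    rw [← hgeo.tsum_eq]
    refine Summable.tsum_le_tsum (fun j => ?_) ((summable_nat_add_iff 2).mpr hs) hgeo.summable
    rw [pow_add, mul_comm (q ^ j)]
    exact mul_le_mul_of_nonneg_right (hv _) (by positivity)
  refine ⟨hs, htail, ?_⟩
  rw [← hs.sum_add_tsum_nat_add 2]
  simp only [Finset.sum_range_succ, Finset.sum_range_zero, pow_zero, pow_one, zero_add, mul_one]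
  linarith

/-- The value `∑ n ^ (-5/4)`. -/
noncomputable def zetaConst : ℝ := ∑' n : ℕ, (n : ℝ) ^ (-(5 / 4) : ℝ)

theorem sum_rpow_le_zetaConst (s : Finset ℕ) : ∑ n ∈ s, (n : ℝ) ^ (-(5 / 4) : ℝ) ≤ zetaConst :=
  Summable.sum_le_tsum s (fun n _ => by positivity) (Real.summable_nat_rpow.mpr (by norm_num))

theorem prime_rpow_le_two_thirds {p : ℕ} (hp : p.Prime) {σ : ℝ} (hσ : σ ≤ 3 / 8) :
    (p : ℝ) ^ (σ - 1) ≤ 2 / 3 := by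
  have hp2 : (2 : ℝ) ≤ p := by exact_mod_cast hp.two_le
  have h1 : (p : ℝ) ^ (σ - 1) ≤ (p : ℝ) ^ (-(5 / 8) : ℝ) :=
    Real.rpow_le_rpow_of_exponent_le (by linarith) (by linarith)
  have h2 : (p : ℝ) ^ (-(5 / 8) : ℝ) ≤ (2 : ℝ) ^ (-(5 / 8) : ℝ) :=
    Real.rpow_le_rpow_of_nonpos (by norm_num) hp2 (by norm_num)
  have h3 : (2 : ℝ) ^ (-(5 / 8) : ℝ) ≤ 2 / 3 := by
    refine le_of_pow_le_pow_left₀ (n := 8) (by norm_num) (by norm_num) ?_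
    rw [← Real.rpow_natCast, ← Real.rpow_mul (by norm_num)]
    have : (-(5 / 8) * ((8 : ℕ) : ℝ) : ℝ) = ((-5 : ℤ) : ℝ) := by norm_num
    rw [this, Real.rpow_intCast]
    norm_num
  linarith

section EulerBounds

variable {h : ArithmeticFunction ℂ}

theorem weighted_prime_pow_eq (h : ArithmeticFunction ℂ) (σ : ℝ) (p k : ℕ) :
    ‖h (p ^ k)‖ * ((p ^ k : ℕ) : ℝ) ^ (σ - 1) = ‖h (p ^ k)‖ * ((p : ℝ) ^ (σ - 1)) ^ k := by
  rw [Nat.cast_pow, Real.rpow_pow_comm p.cast_nonneg]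

/-- With `q = p ^ (σ - 1) ≤ 2 / 3`, the terms of order at least two in an Euler factor total at most
`2 q² / (1 - q) ≤ 6 q²`. As `σ ≤ 3 / 8`, `q² ≤ p ^ (-5/4)` is summable, so only the linear terms
matter. -/
theorem weighted_smooth_sum (hm : h.IsMultiplicative)
    (hb : ∀ p k : ℕ, p.Prime → ‖h (p ^ k)‖ ≤ 2) {σ : ℝ} (hσ : σ ≤ 3 / 8) (N : ℕ) :
    Summable (fun n : N.smoothNumbers => ‖h n‖ * ((n : ℕ) : ℝ) ^ (σ - 1)) ∧
      ∑' n : N.smoothNumbers, ‖h n‖ * ((n : ℕ) : ℝ) ^ (σ - 1) ≤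
        Real.exp (∑ p ∈ N.primesBelow, ‖h p‖ * (p : ℝ) ^ (σ - 1)) * Real.exp (6 * zetaConst) := by
  set F : ℕ → ℝ := fun n => ‖h n‖ * (n : ℝ) ^ (σ - 1) with hF
  have hF0 : ∀ n, 0 ≤ F n := fun n => by positivity
  have hpow : ∀ p k : ℕ, F (p ^ k) = ‖h (p ^ k)‖ * ((p : ℝ) ^ (σ - 1)) ^ k := fun p k =>
    weighted_prime_pow_eq h σ p k
  have hq : ∀ {p : ℕ}, p.Prime → (p : ℝ) ^ (σ - 1) ≤ 2 / 3 := fun hp =>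
    prime_rpow_le_two_thirds hp hσ
  have main := EulerProduct.summable_and_hasSum_smoothNumbers_prod_primesBelow_tsum (f := F)
    (by simp [hF, hm.map_one])
    (fun {m n} hmn => by
      simp only [hF, hm.map_mul_of_coprime hmn, norm_mul, Nat.cast_mul]
      rw [Real.mul_rpow m.cast_nonneg n.cast_nonneg]; ring)
    (fun {p} hp => by
      simp only [hpow, norm_mul, norm_norm, norm_pow]
      simpa [Real.norm_of_nonneg (Real.rpow_nonneg p.cast_nonneg (σ - 1))] using
        (summable_and_tsum_le_of_norm_le_two (v := fun k => h (p ^ k)) (fun j => hb p j hp)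
          (Real.rpow_nonneg p.cast_nonneg (σ - 1)) ((hq hp).trans_lt (by norm_num))).1) N
  refine ⟨main.2.summable, ?_⟩
  rw [main.2.tsum_eq, ← Real.exp_add]
  calc ∏ p ∈ N.primesBelow, ∑' k, F (p ^ k)
      ≤ ∏ p ∈ N.primesBelow,
          Real.exp (‖h p‖ * (p : ℝ) ^ (σ - 1) + 6 * (p : ℝ) ^ (-(5 / 4) : ℝ)) := by
        refine Finset.prod_le_prod (fun p _ => tsum_nonneg fun k => hF0 _) fun p hp => ?_
        have hp' := Nat.prime_of_mem_primesBelow hp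
        set q := (p : ℝ) ^ (σ - 1) with hqdef
        have hq0 : 0 ≤ q := Real.rpow_nonneg p.cast_nonneg _
        have hq1 := hq hp'
        have h1 := (summable_and_tsum_le_of_norm_le_two (v := fun k => h (p ^ k))
          (fun j => hb p j hp') hq0 (hq1.trans_lt (by norm_num))).2.2
        simp only [pow_zero, pow_one, hm.map_one, norm_one] at h1
        have h2 : q ^ 2 / (1 - q) ≤ 3 * q ^ 2 := by
          rw [div_le_iff₀ (by linarith)]
          nlinarith [sq_nonneg q]
        have h3 : q ^ 2 ≤ (p : ℝ) ^ (-(5 / 4) : ℝ) := by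
          rw [hqdef, ← Real.rpow_natCast, ← Real.rpow_mul p.cast_nonneg]
          exact Real.rpow_le_rpow_of_exponent_le (by exact_mod_cast hp'.one_lt.le)
            (by push_cast; linarith)
        simp only [hpow]
        refine h1.trans (le_trans ?_ (Real.add_one_le_exp _))
        linarith
    _ = Real.exp (∑ p ∈ N.primesBelow,
          (‖h p‖ * (p : ℝ) ^ (σ - 1) + 6 * (p : ℝ) ^ (-(5 / 4) : ℝ))) := (Real.exp_sum _ _).symm
    _ ≤ _ := by
        rw [Real.exp_le_exp, Finset.sum_add_distrib, ← Finset.mul_sum]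
        linarith [sum_rpow_le_zetaConst N.primesBelow]

theorem sum_Ioc_le_tsum_smoothNumbers {F : ℕ → ℝ} (hF : ∀ n, 0 ≤ F n) (M : ℕ)
    (hs : Summable (fun n : (M + 1).smoothNumbers => F n)) :
    ∑ n ∈ Finset.Ioc 0 M, F n ≤ ∑' n : (M + 1).smoothNumbers, F n := by
  have hs' : Summable ((M + 1).smoothNumbers.indicator F) := summable_subtype_iff_indicator.mp hs
  rw [tsum_subtype (M + 1).smoothNumbers F]
  refine le_trans (le_of_eq (Finset.sum_congr rfl fun n hn => ?_))
    (hs'.sum_le_tsum (Finset.Ioc 0 M) fun n _ => Set.indicator_nonneg (fun n _ => hF n) n)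
  obtain ⟨h0, h1⟩ := Finset.mem_Ioc.mp hn
  rw [Set.indicator_of_mem (Nat.mem_smoothNumbers_of_lt h0 (by omega))]

theorem logSum_absValue_le (hm : h.IsMultiplicative)
    (hb : ∀ p k : ℕ, p.Prime → ‖h (p ^ k)‖ ≤ 2) (x : ℝ) :
    logSum (absValue h) x ≤
      Real.exp (6 * zetaConst) * Real.exp (∑ p ∈ primesUpTo x, ‖h p‖ / p) := by
  have hw := weighted_smooth_sum hm hb (σ := 0) (by norm_num) (⌊x⌋₊ + 1)
  simp only [zero_sub, Real.rpow_neg_one, ← div_eq_mul_inv] at hw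
  rw [primesUpTo_eq_primesBelow, mul_comm]
  exact (sum_Ioc_le_tsum_smoothNumbers (F := fun n => ‖h n‖ / n) (fun n => by positivity)
    ⌊x⌋₊ hw.1).trans hw.2

end EulerBounds

/-! ### Slow variation of mean values. -/

theorem meanValue_eq (F : ℕ → ℂ) (x : ℝ) :
    meanValue F x = (1 / (x : ℂ)) * ∑ n ∈ Finset.Ioc 0 ⌊x⌋₊, F n := by
  have : Finset.Icc 1 ⌊x⌋₊ = Finset.Ioc 0 ⌊x⌋₊ := by ext; simp; omega
  rw [meanValue, this]

theorem norm_meanValue_le_one {F : ℕ → ℂ} (hF : ∀ n, ‖F n‖ ≤ 1) {x : ℝ} (hx : 0 < x) :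
    ‖meanValue F x‖ ≤ 1 := by
  rw [meanValue_eq, norm_mul, norm_div, norm_one, Complex.norm_real, Real.norm_of_nonneg hx.le,
    one_div, inv_mul_le_one₀ hx]
  calc ‖∑ n ∈ Finset.Ioc 0 ⌊x⌋₊, F n‖ ≤ ∑ n ∈ Finset.Ioc 0 ⌊x⌋₊, (1 : ℝ) :=
        (norm_sum_le _ _).trans (Finset.sum_le_sum fun n _ => hF n)
    _ = (⌊x⌋₊ : ℝ) := by simp
    _ ≤ x := Nat.floor_le hx.le

section Lipschitz

variable {G : ArithmeticFunction ℂ}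

local notation "κ" => G * ((μ : ArithmeticFunction ℤ) : ArithmeticFunction ℂ)

theorem isMultiplicative_of_map_mul (hG1 : G 1 = 1) (hG : ∀ m n, G (m * n) = G m * G n) :
    G.IsMultiplicative := ⟨hG1, fun {m n} _ => hG m n⟩

theorem isMultiplicative_mul_moebius (hG1 : G 1 = 1) (hG : ∀ m n, G (m * n) = G m * G n) :
    (κ).IsMultiplicative :=
  (isMultiplicative_of_map_mul hG1 hG).mul isMultiplicative_moebius.intCast

variable (G) in
theorem mul_moebius_mul_zeta :
    κ * ((ζ : ArithmeticFunction ℕ) : ArithmeticFunction ℂ) = G := by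
  rw [mul_assoc, coe_moebius_mul_coe_zeta, mul_one]

theorem norm_mul_moebius_prime_pow_succ_le (hG : ∀ m n, G (m * n) = G m * G n)
    (hb : ∀ n, ‖G n‖ ≤ 1) {p : ℕ} (hp : p.Prime) (k : ℕ) :
    ‖(κ) (p ^ (k + 1))‖ ≤ ‖1 - G p‖ := by
  rw [apply_prime_pow_succ_of_mul_eq (G := ((ζ : ArithmeticFunction ℕ) : ArithmeticFunction ℂ))
    (by simp) (fun m n => by by_cases hm : m = 0 <;> by_cases hn : n = 0 <;> simp [hm, hn])
    (mul_moebius_mul_zeta G) hp, pow_succ, hG]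
  have : G (p ^ k) * G p -
      ((ζ : ArithmeticFunction ℕ) : ArithmeticFunction ℂ) p * G (p ^ k) =
      -(G (p ^ k) * (1 - G p)) := by
    simp [hp.ne_zero]; ring
  rw [this, norm_neg, norm_mul]
  exact mul_le_of_le_one_left (norm_nonneg _) (hb _)

theorem norm_mul_moebius_prime_pow_le_two (hG1 : G 1 = 1) (hG : ∀ m n, G (m * n) = G m * G n)
    (hb : ∀ n, ‖G n‖ ≤ 1) (p k : ℕ) (hp : p.Prime) : ‖(κ) (p ^ k)‖ ≤ 2 := by
  cases k with
  | zero => simp [(isMultiplicative_mul_moebius hG1 hG).map_one]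
  | succ k =>
    have h1 := norm_mul_moebius_prime_pow_succ_le hG hb hp k
    have h2 := (norm_sub_le 1 (G p)).trans (add_le_add norm_one.le (hb p))
    linarith

/-- Expand `G = κ * ζ` and replace each `⌊t / n⌋` by `t / n`, at a cost of at most `|κ n|`. -/
theorem norm_meanValue_sub_le {t : ℝ} (ht : 0 < t) :
    ‖meanValue G t - ∑ n ∈ Finset.Ioc 0 ⌊t⌋₊, (κ) n / n‖ ≤
      (∑ n ∈ Finset.Ioc 0 ⌊t⌋₊, absValue (κ) n) / t := by
  have htc : (t : ℂ) ≠ 0 := by exact_mod_cast ht.ne'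
  have h1 : ∑ n ∈ Finset.Ioc 0 ⌊t⌋₊, G n =
      ∑ n ∈ Finset.Ioc 0 ⌊t⌋₊, (κ) n * ((⌊t⌋₊ / n : ℕ) : ℂ) := by
    rw [← sum_Ioc_mul_zeta_eq_sum, mul_moebius_mul_zeta]
  rw [meanValue_eq, h1, Finset.mul_sum, ← Finset.sum_sub_distrib, Finset.sum_div]
  refine (norm_sum_le _ _).trans (Finset.sum_le_sum fun n hn => ?_)
  have hn0 : (0 : ℝ) < n := by exact_mod_cast (Finset.mem_Ioc.mp hn).1
  have hnc : (n : ℂ) ≠ 0 := by exact_mod_cast hn0.ne'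
  have h2 : 1 / (t : ℂ) * ((κ) n * ((⌊t⌋₊ / n : ℕ) : ℂ)) - (κ) n / n =
      (κ) n * (((((⌊t⌋₊ / n : ℕ) : ℝ) - t / n : ℝ)) : ℂ) / t := by
    push_cast
    field_simp
  rw [h2, norm_div, norm_mul, Complex.norm_real, Complex.norm_real, Real.norm_of_nonneg ht.le,
    absValue_apply]
  gcongr
  refine mul_le_of_le_one_right (norm_nonneg _) ?_
  rw [← Nat.floor_div_natCast, Real.norm_eq_abs, abs_sub_le_iff]
  have h3 := Nat.floor_le (div_nonneg ht.le hn0.le)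
  have h4 := Nat.lt_floor_add_one (t / (n : ℝ))
  constructor <;> linarith

theorem one_le_logSum_absValue {h : ArithmeticFunction ℂ} (h1 : h 1 = 1) {x : ℝ} (hx : 1 ≤ x) :
    1 ≤ logSum (absValue h) x := by
  have hm : 1 ∈ Finset.Ioc 0 ⌊x⌋₊ := by
    simp only [Finset.mem_Ioc]; exact ⟨one_pos, (Nat.one_le_floor_iff x).mpr hx⟩
  have := Finset.single_le_sum (f := fun n : ℕ => absValue h n / n)
    (fun n _ => div_nonneg (absValue_nonneg h n) n.cast_nonneg) hm
  simpa [absValue_apply, h1, logSum] using this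

/-- The mean values of a completely multiplicative function in the unit disc vary slowly. -/
theorem norm_meanValue_div_sub_le (hG1 : G 1 = 1) (hG : ∀ m n, G (m * n) = G m * G n)
    (hb : ∀ n, ‖G n‖ ≤ 1) {x w : ℝ} (hx : 1 < x) (hw : 1 ≤ w) :
    ‖meanValue G (x / w) - meanValue G x‖ ≤
      (10 * chebyshevConst + 15) * ((Real.log w + 1) / Real.log x) * logSum (absValue (κ)) x := by
  have hc := chebyshevConst_pos
  have hL : 0 < Real.log x := Real.log_pos hx
  have hlw : 0 ≤ Real.log w := Real.log_nonneg hw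
  have hm := isMultiplicative_mul_moebius hG1 hG
  have hK1 := one_le_logSum_absValue hm.map_one hx.le
  have ha : ∀ n, 0 ≤ absValue (κ) n := absValue_nonneg _
  have hlog := norm_mul_moebius_mul_log_le hG hb
  set K := logSum (absValue (κ)) x with hK
  rw [mul_div_assoc', div_mul_eq_mul_div, le_div_iff₀ hL]
  -- For `w ≤ √x`, `log (x / w)` is comparable to `log x` and the estimates at `x / w` lose only a
  -- factor `2`.
  rcases le_or_gt (2 * Real.log w) (Real.log x) with hcase | hcase
  · have hwx : w ≤ x := (Real.log_le_log_iff (by linarith) (by linarith)).mp (by linarith)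
    have hxw1 : 1 ≤ x / w := (one_le_div (by linarith)).mpr hwx
    have hlxw : Real.log x ≤ 2 * Real.log (x / w) := by
      rw [Real.log_div (by linarith) (by linarith)]; linarith
    have hle : x / w ≤ x := div_le_self (by linarith) hw
    have e1 := norm_meanValue_sub_le (G := G) (t := x) (by linarith)
    have e2 := norm_meanValue_sub_le (G := G) (t := x / w) (by linarith)
    have b1 := sum_mul_log_le ha hlog hx.le
    have b2 := sum_mul_log_le ha hlog hxw1
    have b3 := logSum_sub_mul_log_le ha hlog hw hwx
    have hmono : logSum (absValue (κ)) (x / w) ≤ K := logSum_mono ha hle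
    set A := ∑ n ∈ Finset.Ioc 0 ⌊x⌋₊, absValue (κ) n
    set B := ∑ n ∈ Finset.Ioc 0 ⌊x / w⌋₊, absValue (κ) n
    set X := ∑ n ∈ Finset.Ioc 0 ⌊x⌋₊, (κ) n / (n : ℂ) with hX
    set Y := ∑ n ∈ Finset.Ioc 0 ⌊x / w⌋₊, (κ) n / (n : ℂ) with hY
    have e3 : ‖X - Y‖ ≤ K - logSum (absValue (κ)) (x / w) := by
      have hfl : ⌊x / w⌋₊ ≤ ⌊x⌋₊ := Nat.floor_mono hle
      rw [hX, hY, hK, logSum, logSum, ← Finset.sum_Ioc_consecutive _ (Nat.zero_le _) hfl,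
        ← Finset.sum_Ioc_consecutive _ (Nat.zero_le _) hfl, add_sub_cancel_left,
        add_sub_cancel_left]
      refine (norm_sum_le _ _).trans (le_of_eq (Finset.sum_congr rfl fun n _ => ?_))
      rw [norm_div, Complex.norm_natCast, absValue_apply]
    have c1 : A / x * Real.log x ≤ (2 * chebyshevConst + 1) * K := by
      rw [div_mul_eq_mul_div, div_le_iff₀ (by linarith)]
      linarith
    have hB0 : 0 ≤ B / (x / w) := div_nonneg (Finset.sum_nonneg fun n _ => ha n) (by linarith)
    have c2 : B / (x / w) * Real.log x ≤ 2 * ((2 * chebyshevConst + 1) * K) := by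
      have : B / (x / w) * Real.log (x / w) ≤ (2 * chebyshevConst + 1) * K := by
        rw [div_mul_eq_mul_div, div_le_iff₀ (by linarith)]
        refine b2.trans ?_
        rw [mul_assoc, mul_comm K]
        gcongr
      have := mul_le_mul_of_nonneg_left hlxw hB0
      linarith
    have c3 : (K - logSum (absValue (κ)) (x / w)) * Real.log x ≤
        2 * (2 * (Real.log w + (chebyshevConst + 2)) * K) := by
      have := mul_le_mul_of_nonneg_left hlxw (sub_nonneg.mpr hmono)
      linarith
    have tri : ‖meanValue G (x / w) - meanValue G x‖ ≤
        B / (x / w) + (K - logSum (absValue (κ)) (x / w)) + A / x := by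
      have : meanValue G (x / w) - meanValue G x =
          (meanValue G (x / w) - Y) - (X - Y) - (meanValue G x - X) := by ring
      rw [this]
      refine (norm_sub_le _ _).trans (add_le_add ((norm_sub_le _ _).trans ?_) e1)
      exact add_le_add e2 e3
    have hKw : 0 ≤ K * Real.log w := by positivity
    have hKwc : 0 ≤ chebyshevConst * (K * Real.log w) := by positivity
    calc ‖meanValue G (x / w) - meanValue G x‖ * Real.log x
        ≤ (B / (x / w) + (K - logSum (absValue (κ)) (x / w)) + A / x) * Real.log x := by gcongr
      _ ≤ _ := by nlinarith
  -- Here `log x < 2 log w`, so the trivial bound `2` suffices. This covers `w > x` too, as needed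
  -- when `w` runs over all smooth numbers.
  · have n1 := norm_meanValue_le_one hb (x := x) (by linarith)
    have n2 := norm_meanValue_le_one hb (x := x / w) (by positivity)
    have n3 : ‖meanValue G (x / w) - meanValue G x‖ ≤ 2 :=
      (norm_sub_le _ _).trans (by linarith)
    calc ‖meanValue G (x / w) - meanValue G x‖ * Real.log x ≤ 2 * (2 * Real.log w) := by gcongr
      _ = (4 * Real.log w) * 1 := by ring
      _ ≤ ((10 * chebyshevConst + 15) * (Real.log w + 1)) * K := by
        gcongr
        · nlinarith
        · linarith

theorem logSum_absValue_mul_moebius_le (hG1 : G 1 = 1) (hG : ∀ m n, G (m * n) = G m * G n)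
    (hb : ∀ n, ‖G n‖ ≤ 1) {x : ℝ} :
    logSum (absValue (κ)) x ≤ Real.exp (6 * zetaConst) * Real.exp (primeDistance G x) := by
  refine (logSum_absValue_le (isMultiplicative_mul_moebius hG1 hG)
    (norm_mul_moebius_prime_pow_le_two hG1 hG hb) x).trans ?_
  gcongr
  refine Finset.sum_le_sum fun p hp => ?_
  have h1 := norm_mul_moebius_prime_pow_succ_le hG hb (Finset.mem_filter.mp hp).2 0
  rw [zero_add, pow_one] at h1
  gcongr

end Lipschitz

/-! ### Rankin's exponent and the Euler factors of the quotient. -/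

theorem sum_log_div_prime_le {y : ℝ} (hy : 1 ≤ y) :
    ∑ p ∈ primesUpTo y, Real.log p / p ≤ Real.log y + chebyshevConst := by
  refine le_trans ?_ (mertensSum_le hy)
  have hsub : primesUpTo y ⊆ Finset.Ioc 0 ⌊y⌋₊ := fun p hp => by
    simp only [primesUpTo, Finset.mem_filter, Finset.mem_Icc] at hp
    simp only [Finset.mem_Ioc]; omega
  calc ∑ p ∈ primesUpTo y, Real.log p / p
      = ∑ p ∈ primesUpTo y, vonMangoldt p / p := Finset.sum_congr rfl fun p hp => by
        rw [vonMangoldt_apply_prime (Finset.mem_filter.mp hp).2]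
    _ ≤ _ := Finset.sum_le_sum_of_subset_of_nonneg hsub fun n _ _ =>
        div_nonneg vonMangoldt_nonneg n.cast_nonneg

theorem exp_le_one_add_two_mul {u : ℝ} (h0 : 0 ≤ u) (h1 : u ≤ 1 / 2) : Real.exp u ≤ 1 + 2 * u := by
  refine (Real.exp_bound_div_one_sub_of_interval h0 (by linarith)).trans ?_
  rw [div_le_iff₀ (by linarith)]
  nlinarith

theorem half_le_log {y : ℝ} (hy : 2 ≤ y) : 1 / 2 ≤ Real.log y := by
  linarith [Real.log_le_log (by norm_num) hy, Real.log_two_gt_d9]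

theorem primesUpTo_subset {y x : ℝ} (h : y ≤ x) : primesUpTo y ⊆ primesUpTo x :=
  Finset.filter_subset_filter _ (Finset.Icc_subset_Icc_right (Nat.floor_mono h))

/-- For `p ≤ y`, `σ log p ≤ 1 / 4`, so `p ^ σ = 1 + O(σ log p)`. By Mertens the excess totals `O(σ
log y + σ) = O(1)`. -/
theorem sum_primes_rpow_le {h f : ℕ → ℂ} {x y : ℝ} (hy : 2 ≤ y) (hyx : y ≤ x)
    (hb : ∀ p : ℕ, p.Prime → ‖h p‖ ≤ 2)
    (hsmall : ∀ p : ℕ, p.Prime → (p : ℝ) ≤ y → ‖h p‖ = ‖1 - f p‖)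
    (hlarge : ∀ p : ℕ, p.Prime → y < p → h p = 0) :
    ∑ p ∈ primesUpTo x, ‖h p‖ * (p : ℝ) ^ (1 / (4 * Real.log y) - 1) ≤
      primeDistance f y + (1 + 2 * chebyshevConst) := by
  have hly := half_le_log hy
  set σ := 1 / (4 * Real.log y) with hσ
  have hσ0 : 0 < σ := by positivity
  have hσy : σ * Real.log y = 1 / 4 := by rw [hσ]; field_simp
  have hx0 : 0 ≤ x := by linarith
  have hsub : ∑ p ∈ primesUpTo x, ‖h p‖ * (p : ℝ) ^ (σ - 1) =
      ∑ p ∈ primesUpTo y, ‖h p‖ * (p : ℝ) ^ (σ - 1) := by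
    refine (Finset.sum_subset (primesUpTo_subset hyx) fun p hp hp' => ?_).symm
    have hpp := ((mem_primesUpTo hx0).mp hp).1
    have : y < p := by
      by_contra hcon
      exact hp' ((mem_primesUpTo (by linarith)).mpr ⟨hpp, not_lt.mp hcon⟩)
    simp [hlarge p hpp this]
  have hterm : ∀ p ∈ primesUpTo y, ‖h p‖ * (p : ℝ) ^ (σ - 1) ≤
      ‖1 - f p‖ / p + 4 * σ * (Real.log p / p) := by
    intro p hp
    obtain ⟨hpp, hpy⟩ := (mem_primesUpTo (by linarith)).mp hp
    have hp0 : (0 : ℝ) < p := by exact_mod_cast hpp.pos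
    have h1 : (p : ℝ) ^ σ ≤ 1 + 2 * (σ * Real.log p) := by
      rw [Real.rpow_def_of_pos hp0, mul_comm (Real.log _)]
      refine exp_le_one_add_two_mul (by positivity) ?_
      have := mul_le_mul_of_nonneg_left (Real.log_le_log hp0 hpy) hσ0.le
      linarith
    rw [Real.rpow_sub_one hp0.ne']
    calc ‖h p‖ * ((p : ℝ) ^ σ / p) ≤ ‖h p‖ * ((1 + 2 * (σ * Real.log p)) / p) := by gcongr
      _ = ‖h p‖ / p + ‖h p‖ * (2 * σ * (Real.log p / p)) := by ring
      -- The crude bound `‖h p‖ ≤ 2` is used only on the excess: the leading term must keep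
      -- coefficient `1`, since it is exponentiated.
      _ ≤ ‖h p‖ / p + 2 * (2 * σ * (Real.log p / p)) := by
        gcongr
        exact hb p hpp
      _ = _ := by rw [hsmall p hpp hpy]; ring
  rw [hsub]
  refine (Finset.sum_le_sum hterm).trans ?_
  rw [Finset.sum_add_distrib, ← Finset.mul_sum, primeDistance]
  have h2 := mul_le_mul_of_nonneg_left (sum_log_div_prime_le (y := y) (by linarith))
    (by positivity : 0 ≤ 4 * σ)
  have h3 : 4 * σ ≤ 2 := by nlinarith
  have h4 := mul_le_mul_of_nonneg_right h3 chebyshevConst_pos.le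
  linarith

/-- The Euler factor at `p` of a Dirichlet quotient by a function equal to `1` at `p`. -/
theorem tsum_euler_factor {h f : ℕ → ℂ} {p : ℕ} (hp : p.Prime) (h1 : h 1 = 1) (f1 : f 1 = 1)
    (hf : ∀ k : ℕ, ‖f (p ^ k)‖ ≤ 2) (hh : ∀ k : ℕ, ‖h (p ^ k)‖ ≤ 2)
    (hrec : ∀ k, h (p ^ (k + 1)) = f (p ^ (k + 1)) - f (p ^ k)) :
    ∑' k : ℕ, h (p ^ k) / ((p ^ k : ℕ) : ℂ) =
      (1 + ∑' k : ℕ, f (p ^ (k + 1)) / (p : ℂ) ^ (k + 1)) * (1 - 1 / (p : ℂ)) := by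
  have hq1 : (p : ℝ)⁻¹ < 1 := inv_lt_one_of_one_lt₀ (by exact_mod_cast hp.one_lt)
  have summ : ∀ u : ℕ → ℂ, (∀ k : ℕ, ‖u (p ^ k)‖ ≤ 2) →
      Summable fun k : ℕ => u (p ^ k) / (p : ℂ) ^ k := fun u hu => by
    refine Summable.of_norm ?_
    simpa [div_eq_mul_inv] using
      (summable_and_tsum_le_of_norm_le_two (v := fun k => u (p ^ k)) hu (by positivity) hq1).1
  have sf := summ f hf
  have sf' : Summable fun k : ℕ => f (p ^ (k + 1)) / (p : ℂ) ^ (k + 1) :=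
    (summable_nat_add_iff 1).mpr sf
  have e1 := sf.tsum_eq_zero_add
  simp only [pow_zero, f1, div_one] at e1
  have sh := summ h hh
  simp only [Nat.cast_pow]
  rw [sh.tsum_eq_zero_add]
  simp only [pow_zero, h1, div_one]
  have e2 : ∀ k : ℕ, h (p ^ (k + 1)) / (p : ℂ) ^ (k + 1) =
      f (p ^ (k + 1)) / (p : ℂ) ^ (k + 1) - 1 / (p : ℂ) * (f (p ^ k) / (p : ℂ) ^ k) := fun k => by
    have hpc : (p : ℂ) ≠ 0 := by exact_mod_cast hp.ne_zero
    rw [hrec]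
    field_simp
    ring
  simp only [e2]
  rw [sf'.tsum_sub (sf.mul_left _), tsum_mul_left, e1]
  ring

theorem norm_tsum_euler_factor_sub_one_le {h : ℕ → ℂ} {p : ℕ} (hp : p.Prime) (h1 : h 1 = 1)
    (hh : ∀ k : ℕ, ‖h (p ^ k)‖ ≤ 2) (hp0 : h p = 0) :
    ‖∑' k : ℕ, h (p ^ k) / ((p ^ k : ℕ) : ℂ) - 1‖ ≤ 4 * (1 / (p : ℝ) ^ 2) := by
  have hp2 : (2 : ℝ) ≤ p := by exact_mod_cast hp.two_le
  have hq1 : (p : ℝ)⁻¹ ≤ 1 / 2 := by rw [one_div]; exact inv_anti₀ (by norm_num) hp2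
  have hq0 : (0 : ℝ) ≤ (p : ℝ)⁻¹ := by positivity
  obtain ⟨s, ht, -⟩ := summable_and_tsum_le_of_norm_le_two (v := fun k => h (p ^ k)) hh hq0
    (hq1.trans_lt (by norm_num))
  have hn : ∀ k : ℕ, ‖h (p ^ k) / ((p ^ k : ℕ) : ℂ)‖ = ‖h (p ^ k)‖ * (p : ℝ)⁻¹ ^ k := fun k => by
    simp [div_eq_mul_inv]
  have s' : Summable fun k : ℕ => ‖h (p ^ k) / ((p ^ k : ℕ) : ℂ)‖ := by simpa only [hn] using s
  have split := (Summable.of_norm s').sum_add_tsum_nat_add 2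
  have head : ∑ k ∈ Finset.range 2, h (p ^ k) / ((p ^ k : ℕ) : ℂ) = 1 := by
    simp [Finset.sum_range_succ, h1, hp0]
  rw [← split, head, add_sub_cancel_left]
  have hle : ‖∑' k : ℕ, h (p ^ (k + 2)) / ((p ^ (k + 2) : ℕ) : ℂ)‖ ≤
      ∑' k : ℕ, ‖h (p ^ (k + 2))‖ * (p : ℝ)⁻¹ ^ (k + 2) :=
    tsum_of_norm_bounded ((summable_nat_add_iff 2).mpr s).hasSum fun k => (hn (k + 2)).le
  refine (hle.trans ht).trans ?_
  have : (p : ℝ)⁻¹ ^ 2 / (1 - (p : ℝ)⁻¹) ≤ 2 * (p : ℝ)⁻¹ ^ 2 := by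
    rw [div_le_iff₀ (by linarith)]
    nlinarith [sq_nonneg (p : ℝ)⁻¹]
  rw [one_div, ← inv_pow]
  linarith

theorem sum_inv_sq_primes_le {x y : ℝ} (hy : 2 ≤ y) (hyx : y ≤ x) :
    ∑ p ∈ primesUpTo x \ primesUpTo y, 1 / (p : ℝ) ^ 2 ≤ 2 / y := by
  have hk : 1 ≤ ⌊y⌋₊ := (Nat.one_le_floor_iff y).mpr (by linarith)
  have hk' : (1 : ℝ) ≤ ⌊y⌋₊ := by exact_mod_cast hk
  have hsub : primesUpTo x \ primesUpTo y ⊆ Finset.Ioc ⌊y⌋₊ ⌊x⌋₊ := fun p hp => by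
    simp only [primesUpTo, Finset.mem_sdiff, Finset.mem_filter, Finset.mem_Icc] at hp
    simp only [Finset.mem_Ioc]
    have := hp.1.2
    constructor <;> by_contra hcon
    · exact hp.2 ⟨⟨hp.1.1.1, by omega⟩, this⟩
    · omega
  calc _ ≤ ∑ p ∈ Finset.Ioc ⌊y⌋₊ ⌊x⌋₊, 1 / (p : ℝ) ^ 2 :=
        Finset.sum_le_sum_of_subset_of_nonneg hsub fun n _ _ => by positivity
    _ ≤ (⌊y⌋₊ : ℝ)⁻¹ - (⌊x⌋₊ : ℝ)⁻¹ := by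
        simpa using sum_Ioc_inv_sq_le_sub (α := ℝ) (by omega : ⌊y⌋₊ ≠ 0) (Nat.floor_mono hyx)
    _ ≤ (⌊y⌋₊ : ℝ)⁻¹ := by linarith [inv_nonneg.mpr (Nat.cast_nonneg (α := ℝ) ⌊x⌋₊)]
    _ ≤ 2 / y := by
        rw [inv_le_comm₀ (by linarith) (by positivity), inv_div]
        linarith [Nat.lt_floor_add_one y]

/-- The deviations sum to `t ≤ 8 / y ≤ 4`, and `exp t - 1 ≤ t exp t`. -/
theorem norm_prod_sub_one_le {F : ℕ → ℂ} {x y : ℝ} (hy : 2 ≤ y) (hyx : y ≤ x)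
    (hF : ∀ p ∈ primesUpTo x \ primesUpTo y, ‖F p - 1‖ ≤ 4 * (1 / (p : ℝ) ^ 2)) :
    ‖∏ p ∈ primesUpTo x \ primesUpTo y, F p - 1‖ ≤ 8 * Real.exp 4 * y⁻¹ := by
  have h1 := Finset.norm_prod_one_add_sub_one_le (primesUpTo x \ primesUpTo y)
    (fun p => F p - 1)
  simp only [add_sub_cancel] at h1
  set t := ∑ p ∈ primesUpTo x \ primesUpTo y, ‖F p - 1‖ with ht
  have ht0 : 0 ≤ t := Finset.sum_nonneg fun _ _ => norm_nonneg _
  have ht1 : t ≤ 8 * y⁻¹ := by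
    refine (Finset.sum_le_sum hF).trans ?_
    rw [← Finset.mul_sum]
    have := sum_inv_sq_primes_le hy hyx
    rw [div_eq_mul_inv] at this
    linarith
  have hy' : y⁻¹ ≤ 1 / 2 := by rw [one_div]; exact inv_anti₀ (by norm_num) hy
  have h2 : Real.exp t - 1 ≤ t * Real.exp t := by
    have h3 := Real.add_one_le_exp (-t)
    have h4 : Real.exp (-t) * Real.exp t = 1 := by rw [← Real.exp_add]; simp
    nlinarith [Real.exp_pos t]
  calc _ ≤ Real.exp t - 1 := h1
    _ ≤ t * Real.exp t := h2
    _ ≤ (8 * y⁻¹) * Real.exp 4 := by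
        gcongr
        linarith
    _ = _ := by ring

/-! ### Comparison of the two mean values. -/

/-- The mean value of a convolution, as a sum over smooth numbers. -/
theorem hasSum_meanValue_mul (h G : ArithmeticFunction ℂ) {x : ℝ} (hx : 0 < x) :
    HasSum (fun n : (⌊x⌋₊ + 1).smoothNumbers => h n / ((n : ℕ) : ℂ) * meanValue G (x / (n : ℕ)))
      (meanValue (⇑(h * G)) x) := by
  set u : ℕ → ℂ := fun n => h n / (n : ℂ) * meanValue G (x / n) with hu
  have h1 : meanValue (⇑(h * G)) x = ∑ n ∈ Finset.Ioc 0 ⌊x⌋₊, u n := by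
    rw [meanValue_eq, sum_Ioc_mul_eq_sum_sum, Finset.mul_sum]
    refine Finset.sum_congr rfl fun n hn => ?_
    have hn0 : (n : ℂ) ≠ 0 := by exact_mod_cast (Finset.mem_Ioc.mp hn).1.ne'
    have hx0 : (x : ℂ) ≠ 0 := by exact_mod_cast hx.ne'
    rw [hu]
    simp only [meanValue_eq, Nat.floor_div_natCast]
    push_cast
    field_simp
  have h2 : ∑ n ∈ Finset.Ioc 0 ⌊x⌋₊, u n =
      ∑ n ∈ Finset.Ioc 0 ⌊x⌋₊, (⌊x⌋₊ + 1).smoothNumbers.indicator u n := by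
    refine Finset.sum_congr rfl fun n hn => ?_
    obtain ⟨h0, hnx⟩ := Finset.mem_Ioc.mp hn
    rw [Set.indicator_of_mem (Nat.mem_smoothNumbers_of_lt h0 (by omega))]
  rw [h1, h2]
  -- Smooth `n > x` contribute nothing, as the mean value at `x / n < 1` is an empty sum; including
  -- them makes the full Euler product available.
  refine hasSum_subtype_iff_indicator.mpr (hasSum_sum_of_ne_finset_zero fun n hn => ?_)
  by_cases hmem : n ∈ (⌊x⌋₊ + 1).smoothNumbers
  · rw [Set.indicator_of_mem hmem]
    have hn0 : 0 < n := Nat.pos_of_ne_zero (Nat.ne_zero_of_mem_smoothNumbers hmem)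
    have hlt : ⌊x⌋₊ < n := by
      simp only [Finset.mem_Ioc] at hn
      omega
    simp [hu, meanValue_eq, Nat.floor_div_natCast, Nat.div_eq_of_lt hlt]
  · exact Set.indicator_of_notMem hmem u

/-- From `log n ≤ n ^ σ / σ = 4 log y * n ^ σ` and `1 ≤ 2 log y * n ^ σ`. -/
theorem log_add_one_le {y n : ℝ} (hy : 2 ≤ y) (hn : 1 ≤ n) :
    Real.log n + 1 ≤ 6 * Real.log y * n ^ (1 / (4 * Real.log y)) := by
  have hly := half_le_log hy
  have hσ : 0 < 1 / (4 * Real.log y) := by positivity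
  have h1 := Real.log_le_rpow_div (x := n) (by linarith) hσ
  have h2 := Real.one_le_rpow hn hσ.le
  rw [div_div_eq_mul_div, div_one] at h1
  nlinarith

theorem hasSum_smooth_eulerProduct {h : ArithmeticFunction ℂ} (hm : h.IsMultiplicative)
    (hb : ∀ p k : ℕ, p.Prime → ‖h (p ^ k)‖ ≤ 2) (x : ℝ) :
    HasSum (fun n : (⌊x⌋₊ + 1).smoothNumbers => h n / ((n : ℕ) : ℂ))
      (∏ p ∈ primesUpTo x, ∑' k : ℕ, h (p ^ k) / ((p ^ k : ℕ) : ℂ)) := by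
  rw [primesUpTo_eq_primesBelow]
  refine (EulerProduct.summable_and_hasSum_smoothNumbers_prod_primesBelow_tsum
    (f := fun n => h n / (n : ℂ)) (by simp [hm.map_one]) (fun {m n} hmn => ?_) (fun {p} hp => ?_)
    _).2
  · simp only [hm.map_mul_of_coprime hmn, Nat.cast_mul]
    rw [mul_div_mul_comm]
  · have hq1 : (p : ℝ)⁻¹ < 1 := inv_lt_one_of_one_lt₀ (by exact_mod_cast hp.one_lt)
    simpa [div_eq_mul_inv] using (summable_and_tsum_le_of_norm_le_two
      (v := fun k => h (p ^ k)) (fun j => hb p j hp) (by positivity) hq1).1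

/-- Replacing the mean values of `G` at `x / n` by the one at `x` in the mean value of `h * G`. -/
theorem norm_meanValue_mul_sub_le {h G : ArithmeticFunction ℂ} (hm : h.IsMultiplicative)
    (hb : ∀ p k : ℕ, p.Prime → ‖h (p ^ k)‖ ≤ 2)
    (hG1 : G 1 = 1) (hG : ∀ m n, G (m * n) = G m * G n) (hGb : ∀ n, ‖G n‖ ≤ 1)
    {x y : ℝ} (hx : 1 < x) (hy : 2 ≤ y) :
    ‖meanValue (⇑(h * G)) x - (∏ p ∈ primesUpTo x, ∑' k : ℕ, h (p ^ k) / ((p ^ k : ℕ) : ℂ)) *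
        meanValue G x‖ ≤
      (10 * chebyshevConst + 15) * (6 * (Real.log y / Real.log x)) *
        (Real.exp (6 * zetaConst) * Real.exp (primeDistance G x)) *
        (Real.exp (∑ p ∈ primesUpTo x, ‖h p‖ * (p : ℝ) ^ (1 / (4 * Real.log y) - 1)) *
          Real.exp (6 * zetaConst)) := by
  have hc := chebyshevConst_pos
  have hly := half_le_log hy
  have hL : 0 < Real.log x := Real.log_pos hx
  have hly2 := Real.log_le_log (by norm_num) hy
  -- Since `y ≥ 2`, the exponent is at most `1 / (4 log 2) < 3 / 8`.
  have hσ : 1 / (4 * Real.log y) ≤ 3 / 8 := by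
    rw [div_le_iff₀ (by positivity)]
    linarith [Real.log_two_gt_d9]
  set σ := 1 / (4 * Real.log y) with hσdef
  have hw := weighted_smooth_sum hm hb hσ (⌊x⌋₊ + 1)
  rw [← primesUpTo_eq_primesBelow] at hw
  have hsum := (hasSum_meanValue_mul h G (by linarith : 0 < x)).sub
    ((hasSum_smooth_eulerProduct hm hb x).mul_right (meanValue G x))
  set K := Real.exp (6 * zetaConst) * Real.exp (primeDistance G x) with hK
  have hK0 : 0 ≤ K := by positivity
  set M := (10 * chebyshevConst + 15) * (6 * (Real.log y / Real.log x)) * K with hM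
  have hM0 : 0 ≤ M := by positivity
  have hbound : ∀ n : (⌊x⌋₊ + 1).smoothNumbers,
      ‖h n / ((n : ℕ) : ℂ) * meanValue G (x / (n : ℕ)) - h n / ((n : ℕ) : ℂ) * meanValue G x‖ ≤
        M * (‖h n‖ * ((n : ℕ) : ℝ) ^ (σ - 1)) := by
    rintro ⟨n, hn⟩
    have hn1 : (1 : ℝ) ≤ n := by
      exact_mod_cast Nat.pos_of_ne_zero (Nat.ne_zero_of_mem_smoothNumbers hn)
    have hn0 : (0 : ℝ) < n := by linarith
    have hlip := norm_meanValue_div_sub_le hG1 hG hGb hx hn1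
    have hlog := log_add_one_le hy hn1
    have hKb := logSum_absValue_mul_moebius_le hG1 hG hGb (x := x)
    have hlip' : ‖meanValue G (x / n) - meanValue G x‖ ≤ M * (n : ℝ) ^ σ := by
      have hlogn : 0 ≤ Real.log (n : ℝ) := Real.log_natCast_nonneg n
      calc _ ≤ _ := hlip
        _ ≤ (10 * chebyshevConst + 15) * ((6 * Real.log y * (n : ℝ) ^ σ) / Real.log x) * K := by
          gcongr
          exact zero_le_one.trans (one_le_logSum_absValue
            (isMultiplicative_mul_moebius hG1 hG).map_one hx.le)
        _ = _ := by rw [hM]; ring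
    simp only
    rw [← mul_sub, norm_mul, norm_div, Complex.norm_natCast, Real.rpow_sub_one hn0.ne']
    calc ‖h n‖ / n * ‖meanValue G (x / n) - meanValue G x‖
        ≤ ‖h n‖ / n * (M * (n : ℝ) ^ σ) := by gcongr
      _ = _ := by ring
  rw [← hsum.tsum_eq]
  refine (tsum_of_norm_bounded (hw.1.mul_left M).hasSum hbound).trans ?_
  rw [tsum_mul_left]
  exact mul_le_mul_of_nonneg_left hw.2 hM0

theorem norm_le_one_of_prime {G : ArithmeticFunction ℂ} (hG1 : G 1 = 1)
    (hG : ∀ m n, G (m * n) = G m * G n) (hp : ∀ p : ℕ, p.Prime → ‖G p‖ ≤ 1) (n : ℕ) :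
    ‖G n‖ ≤ 1 := by
  induction n using Nat.recOnMul with
  | zero => simp
  | one => simp [hG1]
  | prime p h => exact hp p h
  | mul a b ha hb =>
    rw [hG, norm_mul]
    exact mul_le_one₀ ha (norm_nonneg _) hb

/-- This merges the exponential from the sum over `h` with the one from the slow variation of `g`
into a single `exp(s(f, x))`. -/
theorem primeDistance_add_eq {f g : ℕ → ℂ} {x y : ℝ} (hy : 0 ≤ y) (hyx : y ≤ x)
    (hsmall : ∀ p : ℕ, p.Prime → (p : ℝ) ≤ y → g p = 1)
    (hlarge : ∀ p : ℕ, p.Prime → y < p → g p = f p) :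
    primeDistance f y + primeDistance g x = primeDistance f x := by
  have hx : 0 ≤ x := hy.trans hyx
  unfold primeDistance
  rw [← Finset.sum_sdiff (primesUpTo_subset hyx), ← Finset.sum_sdiff (primesUpTo_subset hyx)
    (f := fun p => ‖1 - f p‖ / (p : ℝ))]
  have h1 : ∑ p ∈ primesUpTo y, ‖1 - g p‖ / (p : ℝ) = 0 := Finset.sum_eq_zero fun p hp => by
    obtain ⟨hpp, hpy⟩ := (mem_primesUpTo hy).mp hp
    simp [hsmall p hpp hpy]
  have h2 : ∑ p ∈ primesUpTo x \ primesUpTo y, ‖1 - g p‖ / (p : ℝ) =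
      ∑ p ∈ primesUpTo x \ primesUpTo y, ‖1 - f p‖ / (p : ℝ) :=
    Finset.sum_congr rfl fun p hp => by
      obtain ⟨h1, h2⟩ := Finset.mem_sdiff.mp hp
      have hpp := ((mem_primesUpTo hx).mp h1).1
      rw [hlarge p hpp (not_le.mp fun hle => h2 ((mem_primesUpTo hy).mpr ⟨hpp, hle⟩))]
  rw [h1, h2]
  ring

/-- Completely multiplicative functions `ℕ → ℂ` are the monoid homomorphisms `ℕ →*₀ ℂ`
(sending `1` to `1`, and the irrelevant argument `0` to `0`). -/
theorem mainTheorem4 :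
    ∃ C : ℝ, 0 < C ∧
      ∀ f : ArithmeticFunction ℂ, f.IsMultiplicative →
        (∀ p k : ℕ, p.Prime → 1 ≤ k → ‖f (p ^ k)‖ ≤ 1) →
      ∀ x ε : ℝ, 1 < x → Real.log 2 / Real.log x ≤ ε → ε < 1 →
      ∀ g : ℕ →*₀ ℂ,
        (∀ p : ℕ, p.Prime → (p : ℝ) ≤ x ^ ε → g p = 1) →
        (∀ p : ℕ, p.Prime → x ^ ε < (p : ℝ) → g p = f p) →
      ∃ δ : ℂ, ‖δ‖ ≤ C * x ^ (-ε) ∧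
        ‖meanValue f x - eulerTheta f (x ^ ε) * (1 + δ) * meanValue g x‖ ≤
          C * (ε * Real.exp (primeDistance f x)) := by
  have hc := chebyshevConst_pos
  set C₁ := (10 * chebyshevConst + 15) * 6 * Real.exp (6 * zetaConst) * Real.exp (6 * zetaConst) *
    Real.exp (1 + 2 * chebyshevConst) with hC₁
  have hC₁0 : 0 < C₁ := by positivity
  refine ⟨8 * Real.exp 4 + C₁, by positivity, ?_⟩
  intro f hf hfb x ε hx hε hε1 g hgs hgl
  have hL : 0 < Real.log x := Real.log_pos hx
  have hε0 : 0 < ε := lt_of_lt_of_le (div_pos (Real.log_pos (by norm_num)) hL) hε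
  have hx0 : 0 < x := by linarith
  have hyx : x ^ ε ≤ x := by
    simpa using Real.rpow_le_rpow_of_exponent_le hx.le hε1.le
  have hlogy : Real.log (x ^ ε) = ε * Real.log x := Real.log_rpow hx0 ε
  -- This is exactly the hypothesis `log 2 / log x ≤ ε`.
  have hy : 2 ≤ x ^ ε := by
    rw [← Real.log_le_log_iff (by norm_num) (by positivity), hlogy]
    exact (div_le_iff₀ hL).mp hε
  have hinv : x ^ (-ε) = (x ^ ε)⁻¹ := Real.rpow_neg hx0.le ε
  set y := x ^ ε
  have hy0 : 0 ≤ y := by linarith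
  set G : ArithmeticFunction ℂ := ⟨g, map_zero g⟩
  have hGg : ∀ n, G n = g n := fun _ => rfl
  have hG1 : G 1 = 1 := map_one g
  have hG : ∀ m n, G (m * n) = G m * G n := fun m n => map_mul g m n
  have hfp : ∀ p : ℕ, p.Prime → ‖f p‖ ≤ 1 := fun p hp => by simpa using hfb p 1 hp le_rfl
  have hfb0 : ∀ p k : ℕ, p.Prime → ‖f (p ^ k)‖ ≤ 1 := fun p k hp => by
    rcases Nat.eq_zero_or_pos k with rfl | hk
    · simp [hf.map_one]
    · exact hfb p k hp hk
  have hGb : ∀ n, ‖G n‖ ≤ 1 := norm_le_one_of_prime hG1 hG fun p hp => by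
    rw [hGg]
    rcases le_or_gt (p : ℝ) y with hle | hlt
    · simp [hgs p hp hle]
    · rw [hgl p hp hlt]; exact hfp p hp
  -- The Dirichlet quotient of `f` by `G`, since `μ G` is the inverse of `G`.
  set h : ArithmeticFunction ℂ := f * ((μ : ArithmeticFunction ℤ) : ArithmeticFunction ℂ).pmul G
    with hh
  have hm : h.IsMultiplicative :=
    hf.mul (isMultiplicative_moebius.intCast.pmul (isMultiplicative_of_map_mul hG1 hG))
  have hhG : h * G = f := by rw [hh, mul_assoc, moebius_pmul_mul_self hG1 hG, mul_one]
  have hrec : ∀ {p : ℕ}, p.Prime → ∀ k, h (p ^ (k + 1)) = f (p ^ (k + 1)) - G p * f (p ^ k) :=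
    fun hp k => apply_prime_pow_succ_of_mul_eq hG1 hG hhG hp k
  have hrec1 : ∀ {p : ℕ}, p.Prime → h p = f p - G p := fun {p} hp => by
    simpa [hf.map_one] using hrec hp 0
  have hb : ∀ p k : ℕ, p.Prime → ‖h (p ^ k)‖ ≤ 2 := fun p k hp => by
    cases k with
    | zero => simp [hm.map_one]
    | succ k =>
      rw [hrec hp]
      refine (norm_sub_le _ _).trans ?_
      rw [norm_mul]
      linarith [hfb0 p (k + 1) hp, mul_le_one₀ (hGb p) (norm_nonneg _) (hfb0 p k hp)]
  have hlarge : ∀ p : ℕ, p.Prime → y < p → h p = 0 := fun p hp hlt => by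
    rw [hrec1 hp, hGg, hgl p hp hlt, sub_self]
  have hsmall : ∀ p : ℕ, p.Prime → (p : ℝ) ≤ y → ‖h p‖ = ‖1 - f p‖ := fun p hp hle => by
    rw [hrec1 hp, hGg, hgs p hp hle, norm_sub_rev]
  set E : ℕ → ℂ := fun p => ∑' k : ℕ, h (p ^ k) / ((p ^ k : ℕ) : ℂ) with hE
  have htheta : ∏ p ∈ primesUpTo y, E p = eulerTheta f y :=
    Finset.prod_congr rfl fun p hp => by
      obtain ⟨hpp, hpy⟩ := (mem_primesUpTo hy0).mp hp
      refine tsum_euler_factor hpp hm.map_one hf.map_one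
        (fun k => (hfb0 p k hpp).trans (by norm_num)) (fun k => hb p k hpp) fun k => ?_
      rw [hrec hpp, hGg, hgs p hpp hpy, one_mul]
  have hprod : ∏ p ∈ primesUpTo x, E p =
      eulerTheta f y * (1 + (∏ p ∈ primesUpTo x \ primesUpTo y, E p - 1)) := by
    rw [← Finset.prod_sdiff (primesUpTo_subset hyx), htheta]
    ring
  -- `1 + δ` is the product of the Euler factors of `h` at the primes in `(y, x]`.
  refine ⟨∏ p ∈ primesUpTo x \ primesUpTo y, E p - 1, ?_, ?_⟩
  · have hδ := norm_prod_sub_one_le (F := E) hy hyx fun p hp => by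
      obtain ⟨h1, h2⟩ := Finset.mem_sdiff.mp hp
      have hpp := ((mem_primesUpTo hx0.le).mp h1).1
      exact norm_tsum_euler_factor_sub_one_le hpp hm.map_one (fun k => hb p k hpp)
        (hlarge p hpp (not_le.mp fun hle => h2 ((mem_primesUpTo hy0).mpr ⟨hpp, hle⟩)))
    rw [hinv]
    refine hδ.trans ?_
    gcongr
    linarith
  · rw [← hprod]
    have hmain := norm_meanValue_mul_sub_le hm hb hG1 hG hGb hx hy
    have hsum := sum_primes_rpow_le (h := h) (f := f) hy hyx
      (fun p hp => by simpa using hb p 1 hp) hsmall hlarge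
    have hdist := primeDistance_add_eq (f := f) (g := g) hy0 hyx hgs hgl
    have hratio : Real.log y / Real.log x = ε := by rw [hlogy]; field_simp
    rw [hhG, hratio] at hmain
    refine hmain.trans ?_
    calc _ ≤ (10 * chebyshevConst + 15) * (6 * ε) *
            (Real.exp (6 * zetaConst) * Real.exp (primeDistance G x)) *
            (Real.exp (primeDistance f y + (1 + 2 * chebyshevConst)) *
              Real.exp (6 * zetaConst)) := by gcongr
      _ = C₁ * (ε * Real.exp (primeDistance f x)) := by
          rw [← hdist, Real.exp_add (primeDistance f y) (1 + _),
            Real.exp_add (primeDistance f y) (primeDistance g x), hC₁]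
          change _ * (_ * Real.exp (primeDistance g x)) * _ = _
          ring
      _ ≤ _ := by
          gcongr
          linarith [Real.exp_pos 4]
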